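/- Let $n\ge d\ge 3$ be integers. Then there exist a convex $d$-polytope $P\subset\mathbb R^d$ and an enumeration $x_0,x_1,\dots,x_n$ of its vertices, without repetition, such that the facets (the $(d-1)$-dimensional faces) of $P$ are exactly the sets $$T_i=\operatorname{conv}\{x_i,x_{i+1},\dots,x_{i+d-1}\}\qquad(0\le i\le n-d+1)$$ and $$E_j=\operatorname{conv}\{x_0,x_{j-(d-2)},\dots,x_{j-1},x_{j+1},\dots,x_{j+(d-2)}\}\qquad(2\le j\le n),$$ under the convention $x_t=x_0$ for $t\le 0$ and $x_t=x_n$ for $t\ge n$. In other words, a $d$-braxtope with $n+1$ vertices is realizable in $\mathbb R^d$ for all $n\ge d\ge 3$. -/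

import Mathlib

/-! ## Convex polytopes, faces and vertex arrays -/

section Polytope

variable {V : Type*} [NormedAddCommGroup V] [NormedSpace ℝ V]

/-- The dimension of (the affine hull of) a nonempty set. It is only used for nonempty sets. -/
noncomputable def affineDimension (S : Set V) : ℕ :=
  Module.finrank ℝ (vectorSpan ℝ S)

/-- A (convex) `d`-polytope: the convex hull of a finite nonempty set of points, of
dimension `d`. -/
def IsConvexPolytope (d : ℕ) (P : Set V) : Prop :=
  (∃ S : Set V, S.Finite ∧ S.Nonempty ∧ P = convexHull ℝ S) ∧ affineDimension P = d

/-- The set of `i`-dimensional faces of `P`, `i ≥ 0`. A nonempty face is the set of points of `P`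
at which some linear functional attains its maximum on `P`. -/
def polytopeFaces (i : ℕ) (P : Set V) : Set (Set V) :=
  {F | F.Nonempty ∧ IsExposed ℝ P F ∧ affineDimension F = i}

/-- The vertices of `P`, that is, the points that are (`0`-dimensional) faces of `P`. -/
def polytopeVertices (P : Set V) : Set V :=
  {v | {v} ∈ polytopeFaces 0 P}

/-- `x 0 < x 1 < ⋯ < x n` is a vertex array of `P`: the points `x 0, …, x n` are pairwise distinct
and are exactly the vertices of `P`. -/
def IsVertexArray {n : ℕ} (P : Set V) (x : Fin (n + 1) → V) : Prop :=
  Function.Injective x ∧ Set.range x = polytopeVertices P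

/-! ## Braxtopes -/

/-- The index convention `x_t = x_0` for `t ≤ 0` and `x_t = x_n` for `t ≥ n`. -/
def clampIndex (n : ℕ) (t : ℤ) : Fin (n + 1) :=
  ⟨min t.toNat n, Nat.lt_succ_of_le (min_le_right _ _)⟩

/-- `T_i = [x_i, x_{i+1}, …, x_{i+d-1}]`. -/
def braxtopeT (d : ℕ) {n : ℕ} (x : Fin (n + 1) → V) (i : ℤ) : Set V :=
  convexHull ℝ ((fun t : ℤ => x (clampIndex n t)) '' {t | i ≤ t ∧ t ≤ i + (d : ℤ) - 1})

/-- `E_j = [x_0, x_{j-(d-2)}, …, x_{j-1}, x_{j+1}, …, x_{j+(d-2)}]`, where the integer indices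
are subject to the convention of `clampIndex`. -/
def braxtopeE (d : ℕ) {n : ℕ} (x : Fin (n + 1) → V) (j : ℤ) : Set V :=
  convexHull ℝ (insert (x 0) ((fun t : ℤ => x (clampIndex n t)) ''
    {t | j - ((d : ℤ) - 2) ≤ t ∧ t ≤ j + ((d : ℤ) - 2) ∧ t ≠ j}))

/-- For `n ≥ d ≥ 3`: `P` is a `d`-braxtope with the vertex array `x 0 < x 1 < ⋯ < x n`. -/
structure IsBraxtope (d : ℕ) {n : ℕ} (P : Set V) (x : Fin (n + 1) → V) : Prop where
  isConvexPolytope : IsConvexPolytope d P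
  isVertexArray : IsVertexArray P x
  facets_eq : polytopeFaces (d - 1) P =
    {F | ∃ i : ℤ, 0 ≤ i ∧ i ≤ (n : ℤ) - d + 1 ∧ F = braxtopeT d x i} ∪
    {F | ∃ j : ℤ, 2 ≤ j ∧ j ≤ (n : ℤ) ∧ F = braxtopeE d x j}

end Polytope

/-!
For points `x 0, …, x n` and an affine functional `c - f`, consider the slacks `c - f (x m)`, scaled
by positive weights. The points are chosen such that the scaled slacks are precisely the solutions
of the recurrence `g m + g (m + d) = g 0 + 2 g (m + 1) + 2 g (m + d - 1)` for `1 ≤ m`, `m + d ≤ n`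
(`isBraxSeq_slack`, `IsBraxSeq.exists_slack`). To this end the homogenized points
`(weight, weight • x m)` follow the recurrence themselves, starting from the vertices
`0, e₁, …, e_d` of a simplex with weights `1`; the weights stay positive since the recurrence makes
sequences grow. Geometrically, each new point satisfies one affine relation of the sign pattern
`x m + x (m + d) ∼ x 0 + x (m + 1) + x (m + d - 1)` with the earlier ones.

Faces of the polytope correspond to zero sets of nonnegative solutions, so everything reduces to a
study of these. A solution is determined by its values at `0` and on any window of `d` consecutive
indices, these values are arbitrary, and the recurrence is symmetric under `m ↦ n + 1 - m`.

* Each `T_i` and `E_j` carries a nonnegative solution, unique up to scaling, that vanishes exactly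
  there (`exists_isFacetSeq`): prescribe the value `1` at `0` or at one index of a window, and `0` at
  the others, and observe that the solution grows once it has become positive. Uniqueness up to
  scaling says that the face has dimension `d - 1`.
* Each index is the only zero of some nonnegative solution (`exists_isBraxSeq_eq_zero_iff`), so all
  the points are vertices.
* The zeros of any nonnegative nonzero solution lie in some `T_i` or `E_j`
  (`IsBraxSeq.exists_mem_braxFacets`): by growth, two zeros at distance at least `d` force `g 0 = 0`
  and zeros on both ends of the interval between them, and too many zeros in a row make the solution
  vanish. Hence every facet is contained in, and therefore equal to, a listed one.
-/

/-! ### Sequences satisfying the recurrence -/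

/-- The linear recurrence
`g m + g (m + d) = g 0 + 2 g (m + 1) + 2 g (m + d - 1)` on the indices `1, …, n`. The value `g 0`
is a parameter of the recurrence and not its starting value: the recurrence links only `g 1, …, g n`
and is invariant under `m ↦ n + 1 - m`. -/
def IsBraxSeq {E : Type*} [AddCommGroup E] [Module ℝ E] (d n : ℕ) (g : ℕ → E) : Prop :=
  ∀ m, 1 ≤ m → m + d ≤ n → g m + g (m + d) = g 0 + (2 : ℝ) • g (m + 1) + (2 : ℝ) • g (m + d - 1)

/-- The solution of the recurrence (for all `n`) with prescribed values at `0, …, d`. The recursion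
needs `2 ≤ d`; for smaller `d` the sequence `init` is returned unchanged. -/
def braxSeq {E : Type*} [AddCommGroup E] [Module ℝ E] (d : ℕ) (init : ℕ → E) (m : ℕ) : E :=
  if _h : m ≤ d ∨ d < 2 then init m
  else init 0 + (2 : ℝ) • braxSeq d init (m - d + 1) + (2 : ℝ) • braxSeq d init (m - 1)
    - braxSeq d init (m - d)
termination_by m
decreasing_by all_goals omega

/-- The reflection `m ↦ n + 1 - m` of the indices `1, …, n`, fixing the index `0`. -/
def reflectSeq {E : Type*} (n : ℕ) (g : ℕ → E) (m : ℕ) : E := if m = 0 then g 0 else g (n + 1 - m)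

theorem reflectSeq_zero {E : Type*} (n : ℕ) (g : ℕ → E) : reflectSeq n g 0 = g 0 := by
  simp [reflectSeq]

theorem reflectSeq_of_add_eq {E : Type*} {n m k : ℕ} (g : ℕ → E) (hm : 1 ≤ m) (h : m + k = n + 1) :
    reflectSeq n g m = g k := by
  rw [reflectSeq, if_neg (by omega)]
  congr 1
  omega

section

variable {E F : Type*} [AddCommGroup E] [Module ℝ E] [AddCommGroup F] [Module ℝ F]

theorem braxSeq_of_le {d m : ℕ} (init : ℕ → E) (h : m ≤ d) : braxSeq d init m = init m := by
  rw [braxSeq, dif_pos (Or.inl h)]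

theorem isBraxSeq_braxSeq {d : ℕ} (hd : 2 ≤ d) (n : ℕ) (init : ℕ → E) :
    IsBraxSeq d n (braxSeq d init) := by
  intro m hm _
  have h : ¬ (m + d ≤ d ∨ d < 2) := by omega
  rw [braxSeq.eq_1 d init (m + d), dif_neg h, braxSeq_of_le init (Nat.zero_le d)]
  simp only [Nat.add_sub_cancel]
  abel

theorem IsBraxSeq.map {d n : ℕ} {g : ℕ → E} (hg : IsBraxSeq d n g) (f : E →ₗ[ℝ] F) :
    IsBraxSeq d n (fun m => f (g m)) := by
  intro m h1 h2
  have := congrArg f (hg m h1 h2)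
  simpa using this

theorem IsBraxSeq.sub {d n : ℕ} {g h : ℕ → E} (hg : IsBraxSeq d n g) (hh : IsBraxSeq d n h) :
    IsBraxSeq d n (fun m => g m - h m) := by
  intro m h1 h2
  have e1 := hg m h1 h2
  have e2 := hh m h1 h2
  calc g m - h m + (g (m + d) - h (m + d)) = (g m + g (m + d)) - (h m + h (m + d)) := by abel
    _ = _ := by rw [e1, e2]; module

theorem IsBraxSeq.const_smul {d n : ℕ} {g : ℕ → E} (hg : IsBraxSeq d n g) (t : ℝ) :
    IsBraxSeq d n (fun m => t • g m) :=
  hg.map (t • LinearMap.id)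

theorem IsBraxSeq.reflect {d n : ℕ} (hd : 1 ≤ d) {g : ℕ → E} (hg : IsBraxSeq d n g) :
    IsBraxSeq d n (reflectSeq n g) := by
  intro m h1 h2
  have := hg (n + 1 - (m + d)) (by omega) (by omega)
  rw [reflectSeq_zero, reflectSeq_of_add_eq (m := m) (k := n + 1 - (m + d) + d) g h1 (by omega),
    reflectSeq_of_add_eq (m := m + d) (k := n + 1 - (m + d)) g (by omega) (by omega),
    reflectSeq_of_add_eq (m := m + 1) (k := n + 1 - (m + d) + d - 1) g (by omega) (by omega),
    reflectSeq_of_add_eq (m := m + d - 1) (k := n + 1 - (m + d) + 1) g (by omega) (by omega),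
    add_comm, this]
  abel

/-- A solution that vanishes at `0` and on a window of `d` consecutive indices vanishes to the right
of the window. -/
theorem IsBraxSeq.eq_zero_of_window_le {d n s : ℕ} (hd : 2 ≤ d) (hs : 1 ≤ s) {g : ℕ → E}
    (hg : IsBraxSeq d n g) (h0 : g 0 = 0) (hw : ∀ m, s ≤ m → m < s + d → g m = 0) :
    ∀ m, s ≤ m → m ≤ n → g m = 0 := by
  intro m
  induction m using Nat.strong_induction_on with
  | _ m ih =>
    intro h1 h2
    by_cases hm : m < s + d
    · exact hw m h1 hm
    · have e := hg (m - d) (by omega) (by omega)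
      rw [ih (m - d) (by omega) (by omega) (by omega), h0,
        ih (m - d + 1) (by omega) (by omega) (by omega),
        ih (m - d + d - 1) (by omega) (by omega) (by omega)] at e
      simpa [show m - d + d = m by omega] using e

/-- A solution that vanishes at `0` and on a window of `d` consecutive indices is zero. -/
theorem IsBraxSeq.eq_zero_of_window {d n s : ℕ} (hd : 2 ≤ d) (hs : 1 ≤ s) (hsn : s + d ≤ n + 1)
    {g : ℕ → E} (hg : IsBraxSeq d n g) (h0 : g 0 = 0)
    (hw : ∀ m, s ≤ m → m < s + d → g m = 0) : ∀ m ≤ n, g m = 0 := by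
  intro m hm
  rcases Nat.eq_zero_or_pos m with rfl | hm0
  · exact h0
  rcases le_or_gt s m with h | h
  · exact hg.eq_zero_of_window_le hd hs h0 hw m h hm
  · have := (hg.reflect (by omega)).eq_zero_of_window_le (s := n + 2 - s - d) hd (by omega)
      (by rw [reflectSeq_zero, h0])
      (fun k h1 h2 => by
        rw [reflectSeq_of_add_eq (k := n + 1 - k) g (by omega) (by omega)]
        exact hw _ (by omega) (by omega)) (n + 1 - m) (by omega) (by omega)
    rwa [reflectSeq_of_add_eq (k := m) g (by omega) (by omega)] at this

/-- The values of a solution at `0` and on any window of `d` consecutive indices can be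
prescribed. -/
theorem exists_isBraxSeq {d : ℕ} (hd : 2 ≤ d) (n : ℕ) {s : ℕ} (hs : 1 ≤ s) (hsn : s + d ≤ n + 1)
    (b : ℕ → E) :
    ∃ g : ℕ → E, IsBraxSeq d n g ∧ g 0 = b 0 ∧ ∀ m, s ≤ m → m < s + d → g m = b m := by
  induction s, hs using Nat.le_induction generalizing b with
  | base =>
    exact ⟨braxSeq d b, isBraxSeq_braxSeq hd n b, braxSeq_of_le b (Nat.zero_le d),
      fun m _ h => braxSeq_of_le b (by omega)⟩
  | succ s hs ih =>
    -- The value at `s` is the one from which the recurrence produces `b (s + d)`.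
    obtain ⟨g, hg, h0, hw⟩ := ih (by omega) (Function.update b s
      (b 0 + (2 : ℝ) • b (s + 1) + (2 : ℝ) • b (s + d - 1) - b (s + d)))
    rw [Function.update_of_ne (by omega)] at h0
    refine ⟨g, hg, h0, fun m h1 h2 => ?_⟩
    have hw' : ∀ k, s < k → k < s + d → g k = b k := fun k h h' => by
      rw [hw k h.le h', Function.update_of_ne (by omega)]
    by_cases hm : m = s + d
    · have e := hg s hs (by omega)
      rw [hw s le_rfl (by omega), Function.update_self, h0, hw' (s + 1) (by omega) (by omega),
        hw' (s + d - 1) (by omega) (by omega)] at e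
      rw [hm]
      rw [sub_add_eq_add_sub, sub_eq_iff_eq_add] at e
      exact add_left_cancel e
    · exact hw' m (by omega) (by omega)

end

/-! ### Positivity -/

/-- Growth to the right of a window: nonnegative values on the window, the last of which is
positive and at least the first. -/
theorem IsBraxSeq.pos_of_window {d n s : ℕ} (hd : 2 ≤ d) (hs : 1 ≤ s) {g : ℕ → ℝ}
    (hg : IsBraxSeq d n g) (h0 : 0 ≤ g 0) (hw : ∀ m, s ≤ m → m < s + d → 0 ≤ g m)
    (hle : g s ≤ g (s + d - 1)) (hpos : 0 < g (s + d - 1)) :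
    ∀ k, s + d ≤ k + 1 → k ≤ n → 0 < g k := by
  have key : ∀ k, s + d - 1 ≤ k → k ≤ n →
      (∀ m, s ≤ m → m ≤ k → 0 ≤ g m) ∧ g (k + 1 - d) ≤ g k ∧ 0 < g k := by
    intro k hk
    induction k, hk using Nat.le_induction with
    | base =>
      intro _
      exact ⟨fun m h1 h2 => hw m h1 (by omega), by
        rwa [show s + d - 1 + 1 - d = s by omega], hpos⟩
    | succ k hk ih =>
      intro hkn
      obtain ⟨i1, i2, i3⟩ := ih (by omega)
      have e := hg (k + 1 - d) (by omega) (by omega)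
      rw [show k + 1 - d + d = k + 1 by omega, show k + 1 - 1 = k by omega,
        show k + 1 - d + 1 = k + 1 + 1 - d by omega] at e
      simp only [smul_eq_mul] at e
      have i4 := i1 (k + 1 + 1 - d) (by omega) (by omega)
      refine ⟨fun m h1 h2 => ?_, by linarith, by linarith⟩
      rcases Nat.lt_or_ge m (k + 1) with h | h
      · exact i1 m h1 (by omega)
      · rw [show m = k + 1 by omega]; linarith
  exact fun k h1 h2 => (key k (by omega) h2).2.2

/-- With parameter `1` and values in `[0, 1]` on a window, the value following the window is
`1 - g s + 2 g (s + 1) + 2 g (s + d - 1)`. It is at least `g (s + 1)`, and positive by the last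
hypothesis, so the solution grows from there on. -/
theorem IsBraxSeq.pos_of_unit_window {d n s : ℕ} (hd : 2 ≤ d) (hs : 1 ≤ s) {g : ℕ → ℝ}
    (hg : IsBraxSeq d n g) (h0 : g 0 = 1) (hw : ∀ m, s ≤ m → m < s + d → 0 ≤ g m ∧ g m ≤ 1)
    (hpos : 0 < 1 - g s + g (s + 1) + g (s + d - 1)) :
    ∀ k, s + d ≤ k → k ≤ n → 0 < g k := by
  intro k hk hkn
  have e := hg s hs (by omega)
  simp only [smul_eq_mul, h0] at e
  have i := hw (s + 1) (by omega) (by omega)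
  have i' := hw s (by omega) (by omega)
  have i'' := hw (s + d - 1) (by omega) (by omega)
  refine hg.pos_of_window (s := s + 1) hd (by omega) (by rw [h0]; norm_num)
    (fun m m1 m2 => ?_) ?_ ?_ k (by omega) hkn
  · rcases Nat.lt_or_ge m (s + d) with h | h
    · exact (hw m (by omega) h).1
    · rw [show m = s + d by omega]; linarith
  · rw [show s + 1 + d - 1 = s + d by omega]; linarith
  · rw [show s + 1 + d - 1 = s + d by omega]; linarith

/-- The two-sided form of `IsBraxSeq.pos_of_unit_window`. -/
theorem IsBraxSeq.pos_off_unit_window {d n s : ℕ} (hd : 2 ≤ d) (hs : 1 ≤ s) (hsn : s + d ≤ n + 1)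
    {g : ℕ → ℝ} (hg : IsBraxSeq d n g) (h0 : g 0 = 1)
    (hw : ∀ m, s ≤ m → m < s + d → 0 ≤ g m ∧ g m ≤ 1)
    (hpos : 0 < 1 - g s + g (s + 1) + g (s + d - 1))
    (hpos' : 0 < 1 - g (s + d - 1) + g (s + d - 2) + g s) :
    ∀ k ≤ n, (k < s ∨ s + d ≤ k) → 0 < g k := by
  intro k hkn hk
  rcases Nat.eq_zero_or_pos k with rfl | hk0
  · rw [h0]; exact one_pos
  rcases hk with hk | hk
  · have := (hg.reflect (by omega)).pos_of_unit_window (s := n + 2 - s - d) hd (by omega)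
      (by rw [reflectSeq_zero, h0])
      (fun k h1 h2 => by
        rw [reflectSeq_of_add_eq (k := n + 1 - k) g (by omega) (by omega)]
        exact hw _ (by omega) (by omega))
      (by
        rwa [reflectSeq_of_add_eq (k := s + d - 1) g (by omega) (by omega),
          reflectSeq_of_add_eq (k := s + d - 2) g (by omega) (by omega),
          reflectSeq_of_add_eq (k := s) g (by omega) (by omega)])
      (n + 1 - k) (by omega) (by omega)
    rwa [reflectSeq_of_add_eq (k := k) g (by omega) (by omega)] at this
  · exact hg.pos_of_unit_window hd hs h0 hw hpos k hk hkn

/-- With parameter `0` and a window on which only the interior value at `j` is nonzero: to the right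
of `j` the solution has `d - 2` zeros (as far as the index `n` permits) and is positive
afterwards. -/
theorem IsBraxSeq.right_of_single {d n s j : ℕ} (hs : 1 ≤ s) (hsj : s < j) (hjs : j + 1 < s + d)
    {g : ℕ → ℝ} (hg : IsBraxSeq d n g) (h0 : g 0 = 0) (hj : g j = 1)
    (hw : ∀ m, s ≤ m → m < s + d → m ≠ j → g m = 0) :
    (∀ k, j < k → k + 2 ≤ j + d → k ≤ n → g k = 0) ∧
      ∀ k, j + d ≤ k + 1 → k ≤ n → 0 < g k := by
  have hz : ∀ k, s ≤ k → k + 2 ≤ j + d → k ≤ n → k ≠ j → g k = 0 := by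
    intro k
    induction k using Nat.strong_induction_on with
    | _ k ih =>
      intro k1 k2 k3 k4
      by_cases h : k < s + d
      · exact hw k k1 h k4
      · have e := hg (k - d) (by omega) (by omega)
        rw [ih (k - d) (by omega) (by omega) (by omega) (by omega) (by omega), h0,
          ih (k - d + 1) (by omega) (by omega) (by omega) (by omega) (by omega),
          ih (k - d + d - 1) (by omega) (by omega) (by omega) (by omega) (by omega),
          show k - d + d = k by omega] at e
        simpa using e
  refine ⟨fun k k1 k2 k3 => hz k (by omega) k2 k3 (by omega), fun k k1 k2 => ?_⟩
  have e := hg (j - 1) (by omega) (by omega)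
  rw [hz (j - 1) (by omega) (by omega) (by omega) (by omega), h0, show j - 1 + 1 = j by omega, hj,
    hz (j - 1 + d - 1) (by omega) (by omega) (by omega) (by omega),
    show j - 1 + d = j + d - 1 by omega] at e
  simp only [smul_eq_mul] at e
  refine hg.pos_of_window (s := j) (by omega) (by omega) h0.ge (fun m m1 m2 => ?_)
    (by linarith) (by linarith) k k1 k2
  rcases eq_or_ne m j with rfl | h
  · linarith
  rcases eq_or_ne m (j + d - 1) with rfl | h'
  · linarith
  · exact (hz m (by omega) (by omega) (by omega) h).ge

/-- The mirror image of `IsBraxSeq.right_of_single`. -/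
theorem IsBraxSeq.left_of_single {d n s j : ℕ} (hs : 1 ≤ s) (hsn : s + d ≤ n + 1) (hsj : s < j)
    (hjs : j + 1 < s + d) {g : ℕ → ℝ} (hg : IsBraxSeq d n g) (h0 : g 0 = 0) (hj : g j = 1)
    (hw : ∀ m, s ≤ m → m < s + d → m ≠ j → g m = 0) :
    (∀ k, 1 ≤ k → k < j → j + 2 ≤ k + d → g k = 0) ∧
      ∀ k, 1 ≤ k → k + d ≤ j + 1 → 0 < g k := by
  have h := (hg.reflect (by omega)).right_of_single (s := n + 2 - s - d) (j := n + 1 - j)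
    (by omega) (by omega) (by omega) (by rw [reflectSeq_zero, h0])
    (by rwa [reflectSeq_of_add_eq (k := j) g (by omega) (by omega)])
    (fun k h1 h2 h3 => by
      rw [reflectSeq_of_add_eq (k := n + 1 - k) g (by omega) (by omega)]
      exact hw _ (by omega) (by omega) (by omega))
  constructor
  · intro k h1 h2 h3
    have := h.1 (n + 1 - k) (by omega) (by omega) (by omega)
    rwa [reflectSeq_of_add_eq (k := k) g (by omega) (by omega)] at this
  · intro k h1 h2
    have := h.2 (n + 1 - k) (by omega) (by omega)
    rwa [reflectSeq_of_add_eq (k := k) g (by omega) (by omega)] at this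

/-! ### The facet sequences -/

/-- The index sets of the vertices of the `T_i`. -/
def braxT (d i : ℕ) : Set ℕ := {m | i ≤ m ∧ m < i + d}

/-- The index sets of the vertices of the `E_j`. For `j = n` the index `n` itself belongs to the
set, because it represents the indices `t > n`. -/
def braxE (d n j : ℕ) : Set ℕ := {m | m = 0 ∨ (j + 2 ≤ m + d ∧ m + 2 ≤ j + d ∧ (m ≠ j ∨ j = n))}

/-- The index sets of the vertices of the prospective facets. -/
def braxFacets (d n : ℕ) : Set (Set ℕ) :=
  {Z | (∃ i, i + d ≤ n + 1 ∧ Z = braxT d i) ∨ ∃ j, 2 ≤ j ∧ j ≤ n ∧ Z = braxE d n j}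

/-- On the indices `0, …, n`, the sequence `g` is a nonnegative, nonzero solution with zero set `Z`,
and it is up to scaling the only solution that vanishes on `Z`. Such a sequence describes a facet
with vertices indexed by `Z`. -/
structure IsFacetSeq (d n : ℕ) (Z : Set ℕ) (g : ℕ → ℝ) : Prop where
  isBraxSeq : IsBraxSeq d n g
  nonneg : ∀ m ≤ n, 0 ≤ g m
  eq_zero_iff : ∀ m ≤ n, g m = 0 ↔ m ∈ Z
  exists_ne : ∃ m ≤ n, g m ≠ 0
  unique : ∀ h : ℕ → ℝ, IsBraxSeq d n h → (∀ m ≤ n, m ∈ Z → h m = 0) →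
    ∃ t : ℝ, ∀ m ≤ n, h m = t * g m

/-- Uniqueness up to scaling holds as soon as all but one of the index `0` and the indices of some
window belong to `Z`; the exceptional index is `p`. -/
theorem IsFacetSeq.of_window {d n s p : ℕ} {Z : Set ℕ} {g : ℕ → ℝ} (hd : 2 ≤ d) (hs : 1 ≤ s)
    (hsn : s + d ≤ n + 1) (hg : IsBraxSeq d n g) (hp : p ≤ n) (hgp : g p = 1)
    (hZ : ∀ m ≤ n, m ∈ Z → g m = 0) (hpos : ∀ m ≤ n, m ∉ Z → 0 < g m)
    (hw : ∀ m, s ≤ m → m < s + d → m ≠ p → m ∈ Z) (h0 : 0 ≠ p → 0 ∈ Z) :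
    IsFacetSeq d n Z g where
  isBraxSeq := hg
  nonneg m hm := by
    by_cases h : m ∈ Z
    · exact (hZ m hm h).ge
    · exact (hpos m hm h).le
  eq_zero_iff m hm := ⟨fun h => by_contra fun h' => (hpos m hm h').ne' h, hZ m hm⟩
  exists_ne := ⟨p, hp, by rw [hgp]; exact one_ne_zero⟩
  unique h hh hhZ := by
    have hsub : ∀ m ≤ n, (m ≠ p → m ∈ Z) → h m - h p • g m = 0 := fun m hm hmZ => by
      rcases eq_or_ne m p with rfl | hne
      · simp [hgp]
      · simp [hhZ m hm (hmZ hne), hZ m hm (hmZ hne)]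
    refine ⟨h p, fun m hm => sub_eq_zero.1 ?_⟩
    exact (hh.sub (hg.const_smul (h p))).eq_zero_of_window hd hs hsn
      (hsub 0 (Nat.zero_le n) h0)
      (fun k k1 k2 => hsub k (by omega) (hw k k1 k2)) m hm

theorem exists_isFacetSeq_braxT_zero {d n : ℕ} (hd : 2 ≤ d) (hn : d ≤ n) :
    ∃ g, IsFacetSeq d n (braxT d 0) g := by
  obtain ⟨g, hg, h0, hw⟩ := exists_isBraxSeq hd n (s := 1) le_rfl (by omega)
    (Pi.single d 1 : ℕ → ℝ)
  rw [Pi.single_eq_of_ne (by omega)] at h0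
  have hgd : g d = 1 := by rw [hw d (by omega) (by omega), Pi.single_eq_same]
  have hz : ∀ m, m < d → g m = 0 := fun m hm => by
    rcases Nat.eq_zero_or_pos m with rfl | hm0
    · exact h0
    · rw [hw m hm0 (by omega), Pi.single_eq_of_ne (by omega)]
  refine ⟨g, .of_window (s := 1) (p := d) hd le_rfl (by omega) hg hn hgd
    (fun m _ h => hz m (by simpa using h.2)) (fun m hm h => ?_)
    (fun m h1 h2 h3 => ⟨Nat.zero_le m, by omega⟩) (fun _ => ⟨le_rfl, by omega⟩)⟩
  have hdm : d ≤ m := by simpa [braxT] using h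
  refine hg.pos_of_window (s := 1) hd le_rfl h0.ge (fun k k1 k2 => ?_) ?_ ?_ m (by omega) hm
  · rcases eq_or_ne k d with rfl | hk
    · rw [hgd]; norm_num
    · exact (hz k (by omega)).ge
  · rw [Nat.add_sub_cancel_left, hgd, hz 1 (by omega)]; norm_num
  · rw [Nat.add_sub_cancel_left, hgd]; norm_num

theorem exists_isFacetSeq_braxE_last {d n : ℕ} (hd : 3 ≤ d) (hn : d ≤ n) :
    ∃ g, IsFacetSeq d n (braxE d n n) g := by
  obtain ⟨g, hg⟩ := exists_isFacetSeq_braxT_zero (d := d) (n := n) (by omega) hn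
  have hmem : ∀ m ≤ n, m ≠ 0 → (m ∈ braxE d n n ↔ n + 1 - m ∈ braxT d 0) := fun m hm h0 => by
    simp only [braxE, braxT, Set.mem_ofPred_eq, or_true, and_true]; omega
  have h0E : 0 ∈ braxE d n n := Or.inl rfl
  have h0T : 0 ∈ braxT d 0 := ⟨le_rfl, by omega⟩
  have hr : ∀ f : ℕ → ℝ, ∀ m ≤ n, m ≠ 0 → reflectSeq n f (n + 1 - m) = f m := fun f m hm h0 =>
    reflectSeq_of_add_eq f (by omega) (by omega)
  have hr' : ∀ m ≤ n, m ≠ 0 → reflectSeq n g m = g (n + 1 - m) := fun m hm h0 =>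
    reflectSeq_of_add_eq g (by omega) (by omega)
  refine ⟨reflectSeq n g, hg.isBraxSeq.reflect (by omega), fun m hm => ?_, fun m hm => ?_, ?_,
    fun h hh hz => ?_⟩
  · rcases eq_or_ne m 0 with rfl | h0
    · rw [reflectSeq_zero]; exact hg.nonneg 0 hm
    · rw [hr' m hm h0]; exact hg.nonneg _ (by omega)
  · rcases eq_or_ne m 0 with rfl | h0
    · rw [reflectSeq_zero]; simpa [h0E, h0T] using hg.eq_zero_iff 0 hm
    · rw [hr' m hm h0, hmem m hm h0]; exact hg.eq_zero_iff _ (by omega)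
  · obtain ⟨m, hm, hne⟩ := hg.exists_ne
    have h0 : m ≠ 0 := by
      rintro rfl
      exact hne ((hg.eq_zero_iff 0 hm).2 h0T)
    exact ⟨n + 1 - m, by omega, by rwa [hr g m hm h0]⟩
  · obtain ⟨t, ht⟩ := hg.unique (reflectSeq n h) (hh.reflect (by omega)) (fun m hm hmT => by
      rcases eq_or_ne m 0 with rfl | h0
      · rw [reflectSeq_zero]; exact hz 0 hm h0E
      · rw [reflectSeq_of_add_eq (k := n + 1 - m) h (by omega) (by omega)]
        refine hz _ (by omega) ((hmem _ (by omega) (by omega)).2 ?_)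
        rwa [show n + 1 - (n + 1 - m) = m by omega])
    refine ⟨t, fun m hm => ?_⟩
    rcases eq_or_ne m 0 with rfl | h0
    · simpa [reflectSeq_zero] using ht 0 hm
    · rw [hr' m hm h0, ← ht (n + 1 - m) (by omega), hr h m hm h0]

theorem exists_isFacetSeq_braxT {d n i : ℕ} (hd : 2 ≤ d) (hi : 1 ≤ i) (hin : i + d ≤ n + 1) :
    ∃ g, IsFacetSeq d n (braxT d i) g := by
  obtain ⟨g, hg, h0, hw⟩ := exists_isBraxSeq hd n hi hin (Pi.single 0 1 : ℕ → ℝ)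
  rw [Pi.single_eq_same] at h0
  have hz : ∀ m, i ≤ m → m < i + d → g m = 0 := fun m h1 h2 => by
    rw [hw m h1 h2, Pi.single_eq_of_ne (by omega)]
  refine ⟨g, .of_window (s := i) (p := 0) hd hi hin hg (Nat.zero_le n) h0
    (fun m _ h => hz m h.1 h.2) (fun m hm h => ?_) (fun m h1 h2 h3 => ⟨h1, h2⟩)
    (fun h => absurd rfl h)⟩
  refine hg.pos_off_unit_window hd hi hin h0 (fun k k1 k2 => ?_) ?_ ?_ m hm ?_
  · rw [hz k k1 k2]; norm_num
  · rw [hz _ le_rfl (by omega), hz (i + 1) (by omega) (by omega),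
      hz (i + d - 1) (by omega) (by omega)]; norm_num
  · rw [hz _ le_rfl (by omega), hz (i + d - 2) (by omega) (by omega),
      hz (i + d - 1) (by omega) (by omega)]; norm_num
  · simp only [braxT, Set.mem_ofPred_eq] at h; omega

theorem exists_isFacetSeq_braxE {d n j : ℕ} (hd : 3 ≤ d) (hn : d ≤ n) (hj : 2 ≤ j) (hjn : j < n) :
    ∃ g, IsFacetSeq d n (braxE d n j) g := by
  -- A window that contains `j` in its interior.
  obtain ⟨s, hs, hsn, hsj, hjs⟩ : ∃ s, 1 ≤ s ∧ s + d ≤ n + 1 ∧ s < j ∧ j + 1 < s + d :=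
    ⟨max 1 (j + 2 - d), by omega, by omega, by omega, by omega⟩
  obtain ⟨g, hg, h0, hw⟩ := exists_isBraxSeq (by omega) n hs hsn (Pi.single j 1 : ℕ → ℝ)
  rw [Pi.single_eq_of_ne (by omega)] at h0
  have hgj : g j = 1 := by rw [hw j (by omega) (by omega), Pi.single_eq_same]
  have hz : ∀ m, s ≤ m → m < s + d → m ≠ j → g m = 0 := fun m h1 h2 h3 => by
    rw [hw m h1 h2, Pi.single_eq_of_ne h3]
  obtain ⟨r1, r2⟩ := hg.right_of_single hs hsj hjs h0 hgj hz
  obtain ⟨l1, l2⟩ := hg.left_of_single hs hsn hsj hjs h0 hgj hz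
  refine ⟨g, .of_window (s := s) (p := j) (by omega) hs hsn hg hjn.le hgj
    (fun m hm h => ?_) (fun m hm h => ?_) (fun m h1 h2 h3 => ?_) (fun _ => Or.inl rfl)⟩
  · rcases Nat.eq_zero_or_pos m with rfl | hm0
    · exact h0
    simp only [braxE, Set.mem_ofPred_eq] at h
    rcases Nat.lt_trichotomy m j with h' | h' | h'
    · exact l1 m hm0 h' (by omega)
    · omega
    · exact r1 m h' (by omega) hm
  · simp only [braxE, Set.mem_ofPred_eq] at h
    rcases Nat.lt_trichotomy m j with h' | h' | h'
    · exact l2 m (by omega) (by omega)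
    · rw [h', hgj]; exact one_pos
    · exact r2 m (by omega) hm
  · exact Or.inr ⟨by omega, by omega, Or.inl h3⟩

theorem exists_isFacetSeq {d n : ℕ} (hd : 3 ≤ d) (hn : d ≤ n) {Z : Set ℕ}
    (hZ : Z ∈ braxFacets d n) : ∃ g, IsFacetSeq d n Z g := by
  rcases hZ with ⟨i, hi, rfl⟩ | ⟨j, hj, hjn, rfl⟩
  · rcases Nat.eq_zero_or_pos i with rfl | h
    · exact exists_isFacetSeq_braxT_zero (by omega) hn
    · exact exists_isFacetSeq_braxT (by omega) h hi
  · rcases hjn.eq_or_lt with rfl | h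
    · exact exists_isFacetSeq_braxE_last hd hn
    · exact exists_isFacetSeq_braxE hd hn hj h

/-! ### The vertex sequences -/

/-- Every index in `0, …, n` is the only zero of some nonnegative solution. -/
theorem exists_isBraxSeq_eq_zero_iff {d n p : ℕ} (hd : 3 ≤ d) (hn : d ≤ n) (hp : p ≤ n) :
    ∃ g : ℕ → ℝ, IsBraxSeq d n g ∧ (∀ m ≤ n, 0 ≤ g m) ∧ ∀ m ≤ n, g m = 0 ↔ m = p := by
  suffices h : ∃ g : ℕ → ℝ, IsBraxSeq d n g ∧ g p = 0 ∧ ∀ m ≤ n, m ≠ p → 0 < g m by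
    obtain ⟨g, hg, hgp, hpos⟩ := h
    refine ⟨g, hg, fun m hm => ?_, fun m hm => ⟨fun h => by_contra fun h' =>
      (hpos m hm h').ne' h, fun h => h ▸ hgp⟩⟩
    rcases eq_or_ne m p with rfl | h
    · exact hgp.ge
    · exact (hpos m hm h).le
  rcases Nat.eq_zero_or_pos p with rfl | hp0
  · obtain ⟨g, hg, h0, hw⟩ := exists_isBraxSeq (d := d) (by omega) n (s := 1) le_rfl (by omega)
      (Function.update (fun _ => (1 : ℝ)) 0 0)
    rw [Function.update_self] at h0
    have h1 : ∀ m, 1 ≤ m → m < 1 + d → g m = 1 := fun m m1 m2 => by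
      rw [hw m m1 m2, Function.update_of_ne (by omega)]
    refine ⟨g, hg, h0, fun m hm hm0 => ?_⟩
    rcases Nat.lt_or_ge m (1 + d) with h | h
    · rw [h1 m (by omega) h]; exact one_pos
    · refine hg.pos_of_window (s := 1) (by omega) le_rfl h0.ge (fun k k1 k2 => ?_) ?_ ?_ m
        (by omega) hm
      · rw [h1 k k1 k2]; norm_num
      · rw [h1 1 le_rfl (by omega), h1 (1 + d - 1) (by omega) (by omega)]
      · rw [h1 (1 + d - 1) (by omega) (by omega)]; norm_num
  · obtain ⟨s, hs, hsn, hsp, hps⟩ : ∃ s, 1 ≤ s ∧ s + d ≤ n + 1 ∧ s ≤ p ∧ p < s + d :=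
      ⟨min p (n + 1 - d), by omega, by omega, by omega, by omega⟩
    obtain ⟨g, hg, h0, hw⟩ := exists_isBraxSeq (d := d) (by omega) n hs hsn
      (Function.update (fun _ => (1 : ℝ)) p 0)
    rw [Function.update_of_ne (by omega)] at h0
    have hgp : g p = 0 := by rw [hw p hsp hps, Function.update_self]
    have h1 : ∀ m, s ≤ m → m < s + d → m ≠ p → g m = 1 := fun m m1 m2 h => by
      rw [hw m m1 m2, Function.update_of_ne h]
    have h01 : ∀ m, s ≤ m → m < s + d → 0 ≤ g m ∧ g m ≤ 1 := fun m m1 m2 => by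
      rcases eq_or_ne m p with rfl | h
      · rw [hgp]; norm_num
      · rw [h1 m m1 m2 h]; norm_num
    -- As `d ≥ 3`, of two distinct indices in the window one has the value `1`.
    have hne : ∀ k l, s ≤ k → k < s + d → s ≤ l → l < s + d → k ≠ l → 1 ≤ g k + g l := by
      intro k l k1 k2 l1 l2 hkl
      have hk := h01 k k1 k2
      have hl := h01 l l1 l2
      by_cases h : k = p
      · have := h1 l l1 l2 (by omega)
        linarith
      · have := h1 k k1 k2 h
        linarith
    refine ⟨g, hg, hgp, fun m hm hmp => ?_⟩
    by_cases h : s ≤ m ∧ m < s + d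
    · rw [h1 m h.1 h.2 hmp]; exact one_pos
    · refine hg.pos_off_unit_window (by omega) hs hsn h0 h01 ?_ ?_ m hm (by omega)
      · have := hne (s + 1) (s + d - 1) (by omega) (by omega) (by omega) (by omega) (by omega)
        have := (h01 s le_rfl (by omega)).2
        linarith
      · have := hne (s + d - 2) s (by omega) (by omega) (by omega) (by omega) (by omega)
        have := (h01 (s + d - 1) (by omega) (by omega)).2
        linarith

/-! ### Zero sets of nonnegative solutions -/

/-- Two zeros at distance at least `d` of a nonnegative solution force the parameter to vanish,
and force further zeros between them. -/
theorem IsBraxSeq.zeros_of_zeros {d n p q : ℕ} (hd : 2 ≤ d) {g : ℕ → ℝ} (hg : IsBraxSeq d n g)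
    (hnn : ∀ m ≤ n, 0 ≤ g m) (hp : 1 ≤ p) (hpq : p + d ≤ q) (hqn : q ≤ n) (hgp : g p = 0)
    (hgq : g q = 0) :
    g 0 = 0 ∧ (∀ k, p ≤ k → k + d ≤ q + 1 → g k = 0) ∧
      ∀ k, p + d ≤ k + 1 → k ≤ q → g k = 0 := by
  have up : ∀ l, p + d ≤ l → l ≤ n → g (l - 1) + 2 * g (l + 1 - d) + g 0 ≤ g l := by
    intro l hl
    induction l, hl using Nat.le_induction with
    | base =>
      intro hln
      have e := hg p hp hln
      simp only [smul_eq_mul] at e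
      rw [show p + d + 1 - d = p + 1 by omega]
      have := hnn (p + d - 1) (by omega)
      linarith
    | succ l hl ih =>
      intro hln
      have i1 := ih (by omega)
      have e := hg (l + 1 - d) (by omega) (by omega)
      rw [show l + 1 - d + d = l + 1 by omega, show l + 1 - d + 1 = l + 1 + 1 - d by omega,
        show l + 1 - 1 = l by omega] at e
      simp only [smul_eq_mul] at e
      rw [show l + 1 - 1 = l by omega]
      have j1 := hnn (l - 1) (by omega)
      have j2 := hnn 0 (by omega)
      have j3 := hnn (l + 1 - d) (by omega)
      linarith
  have step : ∀ l, p + d ≤ l → l ≤ n → g l = 0 →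
      g (l - 1) = 0 ∧ g (l + 1 - d) = 0 ∧ g 0 = 0 := by
    intro l h1 h2 h3
    have i := up l h1 h2
    have j1 := hnn (l - 1) (by omega)
    have j2 := hnn 0 (by omega)
    have j3 := hnn (l + 1 - d) (by omega)
    exact ⟨by linarith, by linarith, by linarith⟩
  have down : ∀ i, p + d + i ≤ q + 1 → g (q - i) = 0 := by
    intro i
    induction i with
    | zero => intro _; exact hgq
    | succ i ih =>
      intro hi
      rw [show q - (i + 1) = q - i - 1 by omega]
      exact (step (q - i) (by omega) (by omega) (ih (by omega))).1
  have right : ∀ k, p + d ≤ k + 1 → k ≤ q → g k = 0 := fun k h1 h2 => by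
    have := down (q - k) (by omega)
    rwa [show q - (q - k) = k by omega] at this
  refine ⟨(step q hpq hqn hgq).2.2, fun k h1 h2 => ?_, right⟩
  rcases h1.eq_or_lt with rfl | h1
  · exact hgp
  · have := (step (k + d - 1) (by omega) (by omega) (right _ (by omega) (by omega))).2.1
    rwa [show k + d - 1 + 1 - d = k by omega] at this

/-- The zero set of a nonnegative nonzero solution is contained in the zero set of a facet
sequence. -/
theorem IsBraxSeq.exists_mem_braxFacets {d n : ℕ} (hd : 3 ≤ d) (hn : d ≤ n) {g : ℕ → ℝ}
    (hg : IsBraxSeq d n g) (hnn : ∀ m ≤ n, 0 ≤ g m) (hne : ∃ m ≤ n, g m ≠ 0) :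
    ∃ Z ∈ braxFacets d n, ∀ m ≤ n, g m = 0 → m ∈ Z := by
  classical
  by_cases hex : ∃ m, 1 ≤ m ∧ m ≤ n ∧ g m = 0
  swap
  · refine ⟨braxT d 0, Or.inl ⟨0, by omega, rfl⟩, fun m hm h => ⟨Nat.zero_le m, ?_⟩⟩
    have : m = 0 := by
      by_contra h0
      exact hex ⟨m, by omega, hm, h⟩
    omega
  -- `p` and `q` are the least and the greatest zero in `1, …, n`.
  obtain ⟨p, ⟨hp1, hpn, hgp⟩, hpmin⟩ : ∃ p, (1 ≤ p ∧ p ≤ n ∧ g p = 0) ∧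
      ∀ m, 1 ≤ m → m ≤ n → g m = 0 → p ≤ m :=
    ⟨Nat.find hex, Nat.find_spec hex, fun m h1 h2 h3 => Nat.find_min' hex ⟨h1, h2, h3⟩⟩
  obtain ⟨q, ⟨hq1, hqn, hgq⟩, hqmax⟩ : ∃ q, (1 ≤ q ∧ q ≤ n ∧ g q = 0) ∧
      ∀ m, 1 ≤ m → m ≤ n → g m = 0 → m ≤ q := by
    refine ⟨Nat.findGreatest (fun m => 1 ≤ m ∧ m ≤ n ∧ g m = 0) n,
      Nat.findGreatest_spec (P := fun m => 1 ≤ m ∧ m ≤ n ∧ g m = 0) hpn ⟨hp1, hpn, hgp⟩,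
      fun m h1 h2 h3 => Nat.le_findGreatest h2 ⟨h1, h2, h3⟩⟩
  have hpq : p ≤ q := hpmin q hq1 hqn hgq
  rcases (hnn 0 (Nat.zero_le n)).eq_or_lt' with h0 | h0
  swap
  · -- With `g 0 > 0` the zeros lie in a window.
    have hlt : q < p + d := by
      by_contra h
      exact h0.ne' (hg.zeros_of_zeros (by omega) hnn hp1 (by omega) hqn hgp hgq).1
    refine ⟨braxT d (min p (n + 1 - d)), Or.inl ⟨_, by omega, rfl⟩, fun m hm h => ?_⟩
    have hm0 : m ≠ 0 := by
      rintro rfl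
      exact h0.ne' h
    have := hpmin m (by omega) hm h
    have := hqmax m (by omega) hm h
    simp only [braxT, Set.mem_ofPred_eq]
    omega
  by_cases hqd : q < d
  · refine ⟨braxT d 0, Or.inl ⟨0, by omega, rfl⟩, fun m hm h => ⟨Nat.zero_le m, ?_⟩⟩
    rcases Nat.eq_zero_or_pos m with rfl | hm0
    · omega
    · have := hqmax m hm0 hm h
      omega
  by_cases hpd : n + 2 ≤ p + d
  · refine ⟨braxE d n n, Or.inr ⟨n, by omega, le_rfl, rfl⟩, fun m hm h => ?_⟩
    rcases Nat.eq_zero_or_pos m with rfl | hm0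
    · exact Or.inl rfl
    · have := hpmin m hm0 hm h
      exact Or.inr ⟨by omega, by omega, Or.inr rfl⟩
  -- Otherwise `E_j` contains the zeros for every `j` in the following range with `g j ≠ 0`.
  obtain ⟨j, hj1, hj2, hgj⟩ : ∃ j, q + 2 ≤ j + d ∧ j + 2 ≤ p + d ∧ g j ≠ 0 := by
    by_contra hcon
    have hz : ∀ j, q + 2 ≤ j + d → j + 2 ≤ p + d → g j = 0 := fun j h1 h2 => by
      by_contra h
      exact hcon ⟨j, h1, h2, h⟩
    suffices hw : ∃ s, 1 ≤ s ∧ s + d ≤ n + 1 ∧ ∀ m, s ≤ m → m < s + d → g m = 0 by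
      obtain ⟨s, h1, h2, h3⟩ := hw
      obtain ⟨m, hm, hm'⟩ := hne
      exact hm' (hg.eq_zero_of_window (by omega) h1 h2 h0 h3 m hm)
    rcases Nat.lt_or_ge q (p + d) with h | h
    · rcases Nat.lt_or_ge (q + 2) (p + d) with h' | h'
      · exact ⟨q + 2 - d, by omega, by omega, fun m h1 h2 => hz m (by omega) (by omega)⟩
      rcases Nat.lt_or_ge (q + 1) (p + d) with h'' | h''
      · -- `q = p + d - 2`: the recurrence yields one more zero, at `q + 1`.
        refine ⟨p, hp1, by omega, fun m h1 h2 => ?_⟩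
        rcases Nat.lt_or_ge (m + 1) (p + d) with h3 | h3
        · exact hz m (by omega) (by omega)
        · have e := hg (p - 1) (by omega) (by omega)
          rw [show p - 1 + d - 1 = q by omega, show p - 1 + d = m by omega,
            show p - 1 + 1 = p by omega, h0, hgp, hgq] at e
          simp only [smul_eq_mul] at e
          have i1 := hnn (p - 1) (by omega)
          have i2 := hnn m (by omega)
          linarith
      · refine ⟨p, hp1, by omega, fun m h1 h2 => ?_⟩
        rcases eq_or_ne m p with rfl | hmp
        · exact hgp
        rcases eq_or_ne m q with rfl | hmq
        · exact hgq
        exact hz m (by omega) (by omega)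
    · obtain ⟨-, z1, z2⟩ := hg.zeros_of_zeros (by omega) hnn hp1 h hqn hgp hgq
      refine ⟨p, hp1, by omega, fun m h1 h2 => ?_⟩
      rcases Nat.lt_or_ge (q + 1) (m + d) with h3 | h3
      · rcases Nat.lt_or_ge (m + 1) (p + d) with h4 | h4
        · exact hz m (by omega) (by omega)
        · exact z2 m (by omega) (by omega)
      · exact z1 m h1 (by omega)
  refine ⟨braxE d n j, Or.inr ⟨j, by omega, by omega, rfl⟩, fun m hm h => ?_⟩
  rcases Nat.eq_zero_or_pos m with rfl | hm0
  · exact Or.inl rfl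
  · have := hpmin m hm0 hm h
    have := hqmax m hm0 hm h
    exact Or.inr ⟨by omega, by omega, Or.inl fun h' => hgj (h' ▸ h)⟩

/-! ### Faces of the convex hull of a family of points -/

section

variable {V : Type*} [NormedAddCommGroup V] [NormedSpace ℝ V] {ι : Type*}

/-- The part of a convex hull on a supporting hyperplane is the hull of the generators there. -/
theorem mem_convexHull_image_of_eq {x : ι → V} {f : V →L[ℝ] ℝ} {c : ℝ} (hf : ∀ i, f (x i) ≤ c)
    {v : V} (hv : v ∈ convexHull ℝ (Set.range x)) :
    f v ≤ c ∧ (f v = c → v ∈ convexHull ℝ (x '' {i | f (x i) = c})) := by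
  refine convexHull_min (t := {v | f v ≤ c ∧ (f v = c → v ∈ convexHull ℝ (x '' {i | f (x i) = c}))})
    ?_ ?_ hv
  · rintro _ ⟨i, rfl⟩
    exact ⟨hf i, fun h => subset_convexHull ℝ _ ⟨i, h, rfl⟩⟩
  · refine convex_iff_forall_pos.2 fun u hu w hw a b ha hb hab => ?_
    have e : f (a • u + b • w) = a * f u + b * f w := by simp
    have hc : c = a * c + b * c := by rw [← add_mul, hab, one_mul]
    have h1 := mul_le_mul_of_nonneg_left hu.1 ha.le
    have h2 := mul_le_mul_of_nonneg_left hw.1 hb.le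
    refine ⟨by rw [e]; linarith, fun h => ?_⟩
    rw [e] at h
    have hu' : f u = c := mul_left_cancel₀ ha.ne' (by linarith)
    have hw' : f w = c := mul_left_cancel₀ hb.ne' (by linarith)
    exact convex_convexHull ℝ _ (hu.2 hu') (hw.2 hw') ha.le hb.le hab

theorem eq_of_mem_convexHull_image {x : ι → V} (f : V →ₗ[ℝ] ℝ) {c : ℝ} {Z : Set ι}
    (hf : ∀ i ∈ Z, f (x i) = c) {v : V} (hv : v ∈ convexHull ℝ (x '' Z)) : f v = c := by
  refine convexHull_min (t := {v | f v = c}) ?_ (convex_hyperplane f.isLinear c) hv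
  rintro _ ⟨i, hi, rfl⟩
  exact hf i hi

theorem nonempty_isExposed_convexHull_iff (x : ι → V) (F : Set V) :
    (F.Nonempty ∧ IsExposed ℝ (convexHull ℝ (Set.range x)) F) ↔
      ∃ (f : V →L[ℝ] ℝ) (c : ℝ), (∀ i, f (x i) ≤ c) ∧ {i | f (x i) = c}.Nonempty ∧
        F = convexHull ℝ (x '' {i | f (x i) = c}) := by
  have hx : ∀ i, x i ∈ convexHull ℝ (Set.range x) := fun i => subset_convexHull ℝ _ ⟨i, rfl⟩
  have hsub : ∀ Z : Set ι, convexHull ℝ (x '' Z) ⊆ convexHull ℝ (Set.range x) := fun Z =>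
    convexHull_mono (Set.image_subset_range x Z)
  constructor
  · rintro ⟨⟨v₀, hv₀⟩, hF⟩
    obtain ⟨f, rfl⟩ := hF ⟨v₀, hv₀⟩
    have hle : ∀ i, f (x i) ≤ f v₀ := fun i => hv₀.2 _ (hx i)
    have e : {v ∈ convexHull ℝ (Set.range x) | ∀ y ∈ convexHull ℝ (Set.range x), f y ≤ f v} =
        convexHull ℝ (x '' {i | f (x i) = f v₀}) := by
      ext v
      constructor
      · rintro ⟨h1, h2⟩
        exact (mem_convexHull_image_of_eq hle h1).2 (le_antisymm (hv₀.2 v h1) (h2 v₀ hv₀.1))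
      · intro hv
        refine ⟨hsub _ hv, fun y hy => ?_⟩
        have : f v = f v₀ := eq_of_mem_convexHull_image (f : V →ₗ[ℝ] ℝ) (fun i hi => hi) hv
        rw [this]
        exact hv₀.2 y hy
    refine ⟨f, f v₀, hle, ?_, e⟩
    rw [← Set.image_nonempty (f := x), ← convexHull_nonempty_iff (𝕜 := ℝ), ← e]
    exact ⟨v₀, hv₀⟩
  · rintro ⟨f, c, hle, ⟨i, hi⟩, rfl⟩
    refine ⟨⟨x i, subset_convexHull ℝ _ ⟨i, hi, rfl⟩⟩, fun _ => ⟨f, ?_⟩⟩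
    ext v
    constructor
    · intro hv
      have : f v = c := eq_of_mem_convexHull_image (f : V →ₗ[ℝ] ℝ) (fun i hi => hi) hv
      exact ⟨hsub _ hv, fun y hy => this ▸ (mem_convexHull_image_of_eq hle hy).1⟩
    · rintro ⟨h1, h2⟩
      have h3 := mem_convexHull_image_of_eq hle h1
      exact h3.2 (le_antisymm h3.1 (hi ▸ h2 _ (hx i)))

theorem vectorSpan_convexHull (S : Set V) : vectorSpan ℝ (convexHull ℝ S) = vectorSpan ℝ S := by
  rw [← direction_affineSpan, affineSpan_convexHull, direction_affineSpan]

theorem mem_dualAnnihilator_vectorSpan_iff {x : ι → V} {Z : Set ι} {p : ι} (hp : p ∈ Z)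
    (φ : Module.Dual ℝ V) :
    φ ∈ (vectorSpan ℝ (convexHull ℝ (x '' Z))).dualAnnihilator ↔ ∀ i ∈ Z, φ (x i) = φ (x p) := by
  rw [vectorSpan_convexHull, Submodule.mem_dualAnnihilator]
  constructor
  · intro h i hi
    have := h _ (vsub_mem_vectorSpan ℝ (Set.mem_image_of_mem x hi) (Set.mem_image_of_mem x hp))
    rwa [vsub_eq_sub, map_sub, sub_eq_zero] at this
  · intro h w hw
    have : vectorSpan ℝ (x '' Z) ≤ LinearMap.ker φ := by
      rw [vectorSpan_def, Submodule.span_le]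
      rintro _ ⟨_, ⟨i, hi, rfl⟩, _, ⟨j, hj, rfl⟩, rfl⟩
      simp [h i hi, h j hj]
    exact this hw

end

/-! ### The points -/

/-- The positive solution that serves as the homogenizing coordinate. -/
noncomputable def braxWeight (d : ℕ) : ℕ → ℝ := braxSeq d fun _ => 1

/-- The vector-valued solution with the values `0, e₁, …, e_d` at `0, …, d`. -/
noncomputable def braxLift (d : ℕ) : ℕ → EuclideanSpace ℝ (Fin d) :=
  braxSeq d fun m => if h : 1 ≤ m ∧ m ≤ d then EuclideanSpace.single ⟨m - 1, by omega⟩ 1 else 0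

/-- The points realizing the braxtope: the first `d + 1` of them are `0, e₁, …, e_d`. -/
noncomputable def braxPoint (d m : ℕ) : EuclideanSpace ℝ (Fin d) :=
  (braxWeight d m)⁻¹ • braxLift d m

theorem braxWeight_of_le {d m : ℕ} (h : m ≤ d) : braxWeight d m = 1 := braxSeq_of_le _ h

theorem braxWeight_pos {d : ℕ} (hd : 2 ≤ d) (m : ℕ) : 0 < braxWeight d m := by
  rcases le_or_gt m d with h | h
  · rw [braxWeight_of_le h]; exact one_pos
  · refine (isBraxSeq_braxSeq hd m _).pos_of_window (s := 1) hd le_rfl ?_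
      (fun k k1 k2 => ?_) ?_ ?_ m (by omega) le_rfl
    · rw [braxSeq_of_le _ (Nat.zero_le d)]; exact zero_le_one
    · rw [braxSeq_of_le _ (by omega)]; exact zero_le_one
    · rw [braxSeq_of_le _ (by omega), braxSeq_of_le _ (by omega)]
    · rw [braxSeq_of_le _ (by omega)]; exact one_pos

theorem braxWeight_smul_braxPoint {d : ℕ} (hd : 2 ≤ d) (m : ℕ) :
    braxWeight d m • braxPoint d m = braxLift d m :=
  smul_inv_smul₀ (braxWeight_pos hd m).ne' _

theorem braxPoint_zero (d : ℕ) : braxPoint d 0 = 0 := by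
  rw [braxPoint, braxLift, braxSeq_of_le _ (Nat.zero_le d), dif_neg (by omega), smul_zero]

theorem braxPoint_succ {d : ℕ} (k : Fin d) :
    braxPoint d (k + 1) = EuclideanSpace.single k 1 := by
  rw [braxPoint, braxLift, braxSeq_of_le _ (by omega), dif_pos (by omega),
    braxWeight_of_le (by omega), inv_one, one_smul]
  rfl

/-- The slacks of an affine functional at the points, suitably scaled, satisfy the recurrence. -/
theorem isBraxSeq_slack {d : ℕ} (hd : 2 ≤ d) (n : ℕ) (f : Module.Dual ℝ (EuclideanSpace ℝ (Fin d)))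
    (c : ℝ) : IsBraxSeq d n fun m => braxWeight d m * (c - f (braxPoint d m)) := by
  have e : (fun m => braxWeight d m * (c - f (braxPoint d m))) =
      fun m => c • braxWeight d m - f (braxLift d m) := by
    funext m
    rw [← braxWeight_smul_braxPoint hd m, map_smul, smul_eq_mul, smul_eq_mul]
    ring
  rw [e]
  exact ((isBraxSeq_braxSeq hd n _).const_smul c).sub ((isBraxSeq_braxSeq hd n _).map f)

/-- Conversely every solution arises from an affine functional. -/
theorem IsBraxSeq.exists_slack {d n : ℕ} (hd : 2 ≤ d) (hn : d ≤ n) {g : ℕ → ℝ}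
    (hg : IsBraxSeq d n g) :
    ∃ (f : EuclideanSpace ℝ (Fin d) →L[ℝ] ℝ) (c : ℝ),
      ∀ m ≤ n, g m = braxWeight d m * (c - f (braxPoint d m)) := by
  let f : EuclideanSpace ℝ (Fin d) →L[ℝ] ℝ :=
    ∑ k : Fin d, (g 0 - g (k + 1)) • EuclideanSpace.proj k
  have hf : ∀ k : Fin d, f (braxPoint d (k + 1)) = g 0 - g (k + 1) := fun k => by
    rw [braxPoint_succ]
    simp [f]
  refine ⟨f, g 0, fun m hm => sub_eq_zero.1 ?_⟩
  have hs := isBraxSeq_slack hd n (f : EuclideanSpace ℝ (Fin d) →ₗ[ℝ] ℝ) (g 0)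
  refine (hg.sub hs).eq_zero_of_window (s := 1) hd le_rfl (by omega) ?_ (fun k k1 k2 => ?_) m hm
  · simp [braxWeight_of_le (Nat.zero_le d), braxPoint_zero]
  · obtain ⟨k, rfl⟩ : ∃ l, k = l + 1 := ⟨k - 1, by omega⟩
    have := hf ⟨k, by omega⟩
    simp only at this
    simp [braxWeight_of_le (show k + 1 ≤ d by omega), this]

/-! ### The braxtope -/

section

variable {d n : ℕ}

/-- The face spanned by the points with indices in `Z`. -/
noncomputable def braxHull (d n : ℕ) (Z : Set ℕ) : Set (EuclideanSpace ℝ (Fin d)) :=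
  convexHull ℝ ((fun i : Fin (n + 1) => braxPoint d i) '' {i | (i : ℕ) ∈ Z})

/-- The polytope spanned by the points with the indices `0, …, n`. -/
noncomputable def braxPolytope (d n : ℕ) : Set (EuclideanSpace ℝ (Fin d)) :=
  convexHull ℝ (Set.range fun i : Fin (n + 1) => braxPoint d i)

/-- The zero set of a nonnegative solution, if nonempty, spans an exposed face. -/
theorem IsBraxSeq.isExposed_braxHull (hd : 2 ≤ d) (hn : d ≤ n) {g : ℕ → ℝ} (hg : IsBraxSeq d n g)
    (hnn : ∀ m ≤ n, 0 ≤ g m) {Z : Set ℕ} (hZ : ∀ m ≤ n, g m = 0 ↔ m ∈ Z) (hne : ∃ m ≤ n, m ∈ Z) :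
    (braxHull d n Z).Nonempty ∧ IsExposed ℝ (braxPolytope d n) (braxHull d n Z) := by
  obtain ⟨f, c, hf⟩ := hg.exists_slack hd hn
  have hiff : ∀ i : Fin (n + 1), f (braxPoint d i) = c ↔ (i : ℕ) ∈ Z := fun i => by
    rw [← hZ i (by omega), hf i (by omega), mul_eq_zero, or_iff_right (braxWeight_pos hd i).ne',
      sub_eq_zero, eq_comm]
  refine (nonempty_isExposed_convexHull_iff _ _).2 ⟨f, c, fun i => ?_, ?_, ?_⟩
  · have := hnn i (by omega)
    rw [hf i (by omega)] at this
    exact sub_nonneg.1 (nonneg_of_mul_nonneg_right this (braxWeight_pos hd i))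
  · obtain ⟨m, hm, hmZ⟩ := hne
    exact ⟨⟨m, by omega⟩, (hiff ⟨m, by omega⟩).2 hmZ⟩
  · rw [braxHull]
    simp only [hiff]

/-- An exposed face of the polytope is spanned by the zero set of a nonnegative solution. -/
theorem exists_isBraxSeq_of_isExposed (hd : 2 ≤ d) {F : Set (EuclideanSpace ℝ (Fin d))}
    (hne : F.Nonempty) (hF : IsExposed ℝ (braxPolytope d n) F) :
    ∃ g : ℕ → ℝ, IsBraxSeq d n g ∧ (∀ m ≤ n, 0 ≤ g m) ∧ (∃ m ≤ n, g m = 0) ∧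
      F = braxHull d n {m | g m = 0} := by
  obtain ⟨f, c, hle, ⟨i, hi⟩, rfl⟩ := (nonempty_isExposed_convexHull_iff _ _).1 ⟨hne, hF⟩
  have hiff : ∀ m, braxWeight d m * (c - f (braxPoint d m)) = 0 ↔ f (braxPoint d m) = c :=
    fun m => by
      rw [mul_eq_zero, or_iff_right (braxWeight_pos hd m).ne', sub_eq_zero, eq_comm]
  refine ⟨_, isBraxSeq_slack hd n (f : EuclideanSpace ℝ (Fin d) →ₗ[ℝ] ℝ) c, fun m hm => ?_,
    ⟨i, by omega, (hiff i).2 hi⟩, ?_⟩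
  · exact mul_nonneg (braxWeight_pos hd m).le (sub_nonneg.2 (hle ⟨m, by omega⟩))
  · rw [braxHull]
    congr 2
    ext j
    exact (hiff j).symm

theorem affineDimension_braxPolytope (hn : d ≤ n) :
    affineDimension (braxPolytope d n) = d := by
  have h : vectorSpan ℝ (braxPolytope d n) = ⊤ := by
    rw [braxPolytope, vectorSpan_convexHull, eq_top_iff,
      ← (EuclideanSpace.basisFun (Fin d) ℝ).toBasis.span_eq, Submodule.span_le]
    rintro _ ⟨k, rfl⟩
    have := vsub_mem_vectorSpan ℝ (s := Set.range fun i : Fin (n + 1) => braxPoint d i)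
      ⟨⟨k + 1, by omega⟩, rfl⟩ ⟨0, rfl⟩
    simpa [braxPoint_succ, braxPoint_zero] using this
  rw [affineDimension, h, finrank_top, finrank_euclideanSpace_fin]

/-- By duality the dimension of a facet is determined by the uniqueness of its facet sequence. -/
theorem IsFacetSeq.affineDimension_braxHull (hd : 2 ≤ d) (hn : d ≤ n) {Z : Set ℕ} {g : ℕ → ℝ}
    (hg : IsFacetSeq d n Z g) (hne : ∃ m ≤ n, m ∈ Z) :
    affineDimension (braxHull d n Z) = d - 1 := by
  obtain ⟨f, c, hf⟩ := hg.isBraxSeq.exists_slack hd hn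
  obtain ⟨p, hpn, hp⟩ := hne
  have hfp : ∀ m ≤ n, m ∈ Z → f (braxPoint d m) = c := fun m hm hmZ => by
    have := (hg.eq_zero_iff m hm).2 hmZ
    rw [hf m hm, mul_eq_zero, or_iff_right (braxWeight_pos hd m).ne', sub_eq_zero] at this
    exact this.symm
  set W := vectorSpan ℝ (braxHull d n Z) with hW
  have hmem : ∀ φ : Module.Dual ℝ (EuclideanSpace ℝ (Fin d)), φ ∈ W.dualAnnihilator ↔
      ∀ i : Fin (n + 1), (i : ℕ) ∈ Z → φ (braxPoint d i) = φ (braxPoint d p) := fun φ =>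
    mem_dualAnnihilator_vectorSpan_iff
      (x := fun i : Fin (n + 1) => braxPoint d i) (p := ⟨p, by omega⟩) hp φ
  have hf0 : (f : EuclideanSpace ℝ (Fin d) →ₗ[ℝ] ℝ) ≠ 0 := by
    intro h
    have h' : ∀ v, f v = 0 := fun v => LinearMap.congr_fun h v
    obtain ⟨m, hm, hgm⟩ := hg.exists_ne
    have hc : c = 0 := by rw [← hfp p hpn hp, h']
    exact hgm (by rw [hf m hm, h', hc, sub_zero, mul_zero])
  have hann : W.dualAnnihilator = Submodule.span ℝ {(f : EuclideanSpace ℝ (Fin d) →ₗ[ℝ] ℝ)} := by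
    ext φ
    rw [hmem, Submodule.mem_span_singleton]
    constructor
    · intro hφ
      obtain ⟨t, ht⟩ := hg.unique _ (isBraxSeq_slack hd n φ (φ (braxPoint d p)))
        (fun m hm hmZ => by rw [hφ ⟨m, by omega⟩ hmZ, sub_self, mul_zero])
      have ht' : ∀ m ≤ n, φ (braxPoint d p) - φ (braxPoint d m) = t * (c - f (braxPoint d m)) :=
        fun m hm => mul_left_cancel₀ (braxWeight_pos hd m).ne' (by
          rw [ht m hm, hf m hm, mul_left_comm])
      refine ⟨t, (EuclideanSpace.basisFun (Fin d) ℝ).toBasis.ext fun k => ?_⟩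
      have e0 := ht' 0 (Nat.zero_le n)
      have e1 := ht' (k + 1) (by omega)
      rw [braxPoint_zero, map_zero, map_zero] at e0
      rw [braxPoint_succ] at e1
      simp
      linarith
    · rintro ⟨t, rfl⟩ i hi
      simp [hfp i (by omega) hi, hfp p hpn hp]
  have h := Subspace.finrank_add_finrank_dualAnnihilator_eq W
  rw [hann, finrank_span_singleton hf0, finrank_euclideanSpace_fin] at h
  rw [affineDimension, ← hW]
  omega

theorem exists_mem_of_mem_braxFacets (hd : 2 ≤ d) {Z : Set ℕ}
    (hZ : Z ∈ braxFacets d n) : ∃ m ≤ n, m ∈ Z := by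
  rcases hZ with ⟨i, hi, rfl⟩ | ⟨j, -, -, rfl⟩
  · exact ⟨i, by omega, le_rfl, by omega⟩
  · exact ⟨0, Nat.zero_le n, Or.inl rfl⟩

theorem polytopeFaces_braxPolytope (hd : 3 ≤ d) (hn : d ≤ n) :
    polytopeFaces (d - 1) (braxPolytope d n) = {F | ∃ Z ∈ braxFacets d n, F = braxHull d n Z} := by
  ext F
  constructor
  · rintro ⟨hne, hF, hdim⟩
    obtain ⟨g, hg, hnn, ⟨p, hpn, hp⟩, rfl⟩ := exists_isBraxSeq_of_isExposed (by omega) hne hF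
    have hg0 : ∃ m ≤ n, g m ≠ 0 := by
      by_contra h
      have h' : ∀ m ≤ n, g m = 0 := fun m hm => by_contra fun h'' => h ⟨m, hm, h''⟩
      have : braxHull d n {m | g m = 0} = braxPolytope d n := by
        rw [braxHull, braxPolytope, ← Set.image_univ]
        congr 2
        exact Set.eq_univ_of_forall fun i => h' i (by omega)
      rw [this, affineDimension_braxPolytope hn] at hdim
      omega
    obtain ⟨Z, hZ, hsub⟩ := hg.exists_mem_braxFacets hd hn hnn hg0
    obtain ⟨g', hg'⟩ := exists_isFacetSeq hd hn hZ
    have hdim' := hg'.affineDimension_braxHull (by omega) hn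
      (exists_mem_of_mem_braxFacets (by omega) hZ)
    -- A facet contained in a facet has the same affine hull, so its defining functional is constant
    -- on the larger one.
    have hle : vectorSpan ℝ (braxHull d n {m | g m = 0}) ≤ vectorSpan ℝ (braxHull d n Z) :=
      vectorSpan_mono ℝ (convexHull_mono (Set.image_mono fun i hi => hsub i (by omega) hi))
    have hspan := Submodule.eq_of_le_of_finrank_eq hle (hdim.trans hdim'.symm)
    obtain ⟨f, c, hf⟩ := hg.exists_slack (by omega) hn
    have hiff : ∀ m ≤ n, g m = 0 ↔ f (braxPoint d m) = c := fun m hm => by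
      rw [hf m hm, mul_eq_zero, or_iff_right (braxWeight_pos (by omega) m).ne', sub_eq_zero,
        eq_comm]
    have hfann : (f : EuclideanSpace ℝ (Fin d) →ₗ[ℝ] ℝ) ∈
        (vectorSpan ℝ (braxHull d n Z)).dualAnnihilator := by
      rw [← hspan]
      refine (mem_dualAnnihilator_vectorSpan_iff (x := fun i : Fin (n + 1) => braxPoint d i)
        (p := ⟨p, by omega⟩) hp _).2 fun i hi => ?_
      exact ((hiff i (by omega)).1 hi).trans ((hiff p hpn).1 hp).symm
    refine ⟨Z, hZ, ?_⟩
    rw [braxHull, braxHull]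
    congr 2
    ext i
    refine ⟨fun hi => hsub i (by omega) hi, fun hi => (hiff i (by omega)).2 ?_⟩
    rw [← (hiff p hpn).1 hp]
    exact (mem_dualAnnihilator_vectorSpan_iff (x := fun i : Fin (n + 1) => braxPoint d i)
      (p := ⟨p, by omega⟩) (hsub p hpn hp) _).1 hfann i hi
  · rintro ⟨Z, hZ, rfl⟩
    obtain ⟨g, hg⟩ := exists_isFacetSeq hd hn hZ
    have hne := exists_mem_of_mem_braxFacets (by omega) hZ
    obtain ⟨h1, h2⟩ := hg.isBraxSeq.isExposed_braxHull (by omega) hn hg.nonneg hg.eq_zero_iff hne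
    exact ⟨h1, h2, hg.affineDimension_braxHull (by omega) hn hne⟩

theorem isVertexArray_braxPoint (hd : 3 ≤ d) (hn : d ≤ n) :
    IsVertexArray (braxPolytope d n) fun i : Fin (n + 1) => braxPoint d i := by
  constructor
  · intro i j hij
    obtain ⟨g, hg, -, hz⟩ := exists_isBraxSeq_eq_zero_iff hd hn (Fin.is_le i)
    obtain ⟨f, c, hf⟩ := hg.exists_slack (by omega) hn
    have hi := (hz i (Fin.is_le i)).2 rfl
    rw [hf i (Fin.is_le i), mul_eq_zero, or_iff_right (braxWeight_pos (by omega) _).ne'] at hi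
    refine Fin.ext ((hz j (Fin.is_le j)).1 ?_).symm
    have hij' : braxPoint d i = braxPoint d j := hij
    rw [hf j (Fin.is_le j), ← hij', hi, mul_zero]
  · ext v
    constructor
    · rintro ⟨i, rfl⟩
      obtain ⟨g, hg, hnn, hz⟩ := exists_isBraxSeq_eq_zero_iff hd hn (Fin.is_le i)
      obtain ⟨h1, h2⟩ := hg.isExposed_braxHull (Z := {(i : ℕ)}) (by omega) hn hnn hz
        ⟨i, Fin.is_le i, rfl⟩
      have e : braxHull d n {(i : ℕ)} = {braxPoint d i} := by
        have : {j : Fin (n + 1) | (j : ℕ) ∈ ({(i : ℕ)} : Set ℕ)} = {i} := by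
          ext j
          simp [Fin.ext_iff]
        rw [braxHull, this, Set.image_singleton, convexHull_singleton]
      rw [e] at h1 h2
      exact ⟨h1, h2, by rw [affineDimension, vectorSpan_singleton, finrank_bot]⟩
    · rintro ⟨hne, hF, -⟩
      obtain ⟨g, -, -, ⟨p, hpn, hp⟩, e⟩ := exists_isBraxSeq_of_isExposed (by omega) hne hF
      have : braxPoint d p ∈ ({v} : Set _) := by
        rw [e]
        exact subset_convexHull ℝ _ ⟨⟨p, by omega⟩, hp, rfl⟩
      exact ⟨⟨p, by omega⟩, this⟩

theorem braxtopeT_braxPoint (hd : 1 ≤ d) {i : ℕ} (hi : i + d ≤ n + 1) :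
    braxtopeT d (fun k : Fin (n + 1) => braxPoint d k) i = braxHull d n (braxT d i) := by
  rw [braxtopeT, braxHull]
  congr 1
  ext v
  constructor
  · rintro ⟨t, ⟨h1, h2⟩, rfl⟩
    refine ⟨clampIndex n t, ?_, rfl⟩
    simp only [braxT, clampIndex, Set.mem_ofPred_eq]
    omega
  · rintro ⟨k, ⟨h1, h2⟩, rfl⟩
    have hk : clampIndex n (k : ℕ) = k := by
      ext
      simp only [clampIndex]
      omega
    exact ⟨((k : ℕ) : ℤ), ⟨by omega, by omega⟩, by simp only [hk]⟩

theorem braxtopeE_braxPoint (hd : 3 ≤ d) {j : ℕ} (hj : 2 ≤ j) (hjn : j ≤ n) :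
    braxtopeE d (fun k : Fin (n + 1) => braxPoint d k) j = braxHull d n (braxE d n j) := by
  rw [braxtopeE, braxHull]
  congr 1
  ext v
  constructor
  · rintro (rfl | ⟨t, ⟨h1, h2, h3⟩, rfl⟩)
    · exact ⟨0, Or.inl rfl, rfl⟩
    · refine ⟨clampIndex n t, ?_, rfl⟩
      simp only [braxE, clampIndex, Set.mem_ofPred_eq]
      omega
  · rintro ⟨k, hk, rfl⟩
    simp only [braxE, Set.mem_ofPred_eq] at hk
    by_cases hk0 : k = 0
    · exact Or.inl (by rw [hk0])
    have hk0' : (k : ℕ) ≠ 0 := fun h => hk0 (Fin.ext h)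
    right
    by_cases hkn : (k : ℕ) = n
    · have hc : clampIndex n (n + 1 : ℕ) = k := by
        ext
        simp only [clampIndex]
        omega
      have hc' : clampIndex n (n : ℕ) = k := by
        ext
        simp only [clampIndex]
        omega
      by_cases hjn' : j = n
      · exact ⟨((n + 1 : ℕ) : ℤ), ⟨by omega, by omega, by omega⟩, by simp only [hc]⟩
      · exact ⟨((n : ℕ) : ℤ), ⟨by omega, by omega, by omega⟩, by simp only [hc']⟩
    · have hc : clampIndex n (k : ℕ) = k := by
        ext
        simp only [clampIndex]
        omega
      exact ⟨((k : ℕ) : ℤ), ⟨by omega, by omega, by omega⟩, by simp only [hc]⟩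

end

theorem mainTheorem1 (d n : ℕ) (hd : 3 ≤ d) (hn : d ≤ n) :
    ∃ (P : Set (EuclideanSpace ℝ (Fin d))) (x : Fin (n + 1) → EuclideanSpace ℝ (Fin d)),
      IsBraxtope d P x := by
  refine ⟨braxPolytope d n, fun i => braxPoint d i,
    ⟨⟨_, Set.finite_range _, Set.range_nonempty _, rfl⟩, affineDimension_braxPolytope hn⟩,
    isVertexArray_braxPoint hd hn, ?_⟩
  rw [polytopeFaces_braxPolytope hd hn]
  ext F
  constructor
  · rintro ⟨Z, ⟨i, hi, rfl⟩ | ⟨j, hj, hjn, rfl⟩, rfl⟩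
    · exact Or.inl ⟨i, by omega, by omega, (braxtopeT_braxPoint (by omega) hi).symm⟩
    · exact Or.inr ⟨j, by omega, by omega, (braxtopeE_braxPoint hd hj hjn).symm⟩
  · rintro (⟨i, hi, hin, rfl⟩ | ⟨j, hj, hjn, rfl⟩)
    · lift i to ℕ using hi
      have hi : i + d ≤ n + 1 := by omega
      exact ⟨_, Or.inl ⟨i, hi, rfl⟩, braxtopeT_braxPoint (by omega) hi⟩
    · lift j to ℕ using by omega
      have h1 : 2 ≤ j := by omega
      have h2 : j ≤ n := by omega
      exact ⟨_, Or.inr ⟨j, h1, h2, rfl⟩, braxtopeE_braxPoint hd h1 h2⟩
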